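/- Let $V$ be a complex vector space of finite dimension $n$ with a nondegenerate symmetric bilinear form $(\cdot,\cdot)$. Let $C(V)$ be the Clifford algebra of $V$, with relations $x^2=(x,x)$ for $x\in V$, and identify $C(V)$ with $\bigwedge V$ as a vector space by $u\mapsto\gamma(u)1$, where $\gamma:C(V)\to\operatorname{End}(\bigwedge V)$ is the algebra homomorphism such that, for $x\in V$, $\gamma(x)$ is exterior multiplication by $x$ plus contraction by the linear form $(x,\cdot)$. Let $\mathrm{pr}_0:C(V)\to\bigwedge^0V=\mathbb C$ be the projection onto the component of degree $0$, and let $\alpha$ be the antiautomorphism of $C(V)$ that fixes $V$ pointwise. Let $\mathrm{Spin}(V)$ be the set of all even $g\in C(V)$ such that $g\,\alpha(g)=1$ and $g\,x\,\alpha(g)\in V$ for all $x\in V$; for such $g$ let $T(g):V\to V$ be the linear map $T(g)x=g\,x\,\alpha(g)$. **Theorem 7.10.** Let $g\in\mathrm{Spin}(V)$. 1. If $\det(1+T(g))=0$, then $\mathrm{pr}_0(g)=0$. 2. If $\det(1+T(g))\neq0$, then $$\mathrm{pr}_0(g)=2^{-n/2}\sqrt{\det(1+T(g))}$$ for one of the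 two choices of the complex square root. 3. There are exactly two elements $h\in\mathrm{Spin}(V)$ with $T(h)=T(g)$, namely $g$ and $-g$. If $\det(1+T(g))\ne0$, both choices of the square root are taken by these two elements: for each $s\in\mathbb C$ with $s^2=\det(1+T(g))$, exactly one of them, $h$, satisfies $\mathrm{pr}_0(h)=2^{-n/2}s$. -/

import Mathlib

open CliffordAlgebra

noncomputable section

namespace Spinor

variable {V : Type*} [AddCommGroup V] [Module ℂ V]

/-- The quadratic form `x ↦ (x, x)` of a bilinear form `B = (·, ·)`. -/
abbrev quad (B : LinearMap.BilinForm ℂ V) : QuadraticForm ℂ V := B.toQuadraticMap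

/-- The Clifford algebra `C(V)`: the tensor algebra of `V` modulo the relations
`x ⊗ x = (x, x)`. -/
abbrev Cliff (B : LinearMap.BilinForm ℂ V) : Type _ := CliffordAlgebra (quad B)

/-- The identification `ψ : C(V) → ⋀ V` of the Clifford algebra with the exterior algebra;
see `psi_one` and `psi_ι_mul`, which determine it. -/
def psi (B : LinearMap.BilinForm ℂ V) : Cliff B ≃ₗ[ℂ] ExteriorAlgebra ℂ V :=
  CliffordAlgebra.equivExterior (quad B)

theorem psi_one (B : LinearMap.BilinForm ℂ V) : psi B 1 = 1 := by
  simp [psi, ExteriorAlgebra]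

/-- For symmetric `B` one has `ψ (x u) = x ∧ ψ u + ι(x) (ψ u)`, where `ι(x)` is the contraction by
the linear form `(x, ·)`. Hence `ψ u = γ(u) 1`, where `γ(x) = ε(x) + ι(x)`. -/
theorem psi_ι_mul (B : LinearMap.BilinForm ℂ V) (hB : B.IsSymm) (x : V) (u : Cliff B) :
    psi B (CliffordAlgebra.ι (quad B) x * u) =
      ExteriorAlgebra.ι ℂ x * psi B u +
        CliffordAlgebra.contractLeft (Q := (0 : QuadraticForm ℂ V)) (B x) (psi B u) := by
  have h : QuadraticMap.associated (R := ℂ) (-(quad B)) x = -(B x) := by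
    rw [map_neg, LinearMap.neg_apply]
    congr 2
    exact QuadraticMap.associated_left_inverse ℂ hB.eq
  have h2 := changeForm_ι_mul (changeForm.associated_neg_proof (Q := quad B)) x u
  refine h2.trans ?_
  rw [← sub_neg_eq_add]
  congr 1
  rw [← LinearMap.neg_apply, ← map_neg, ← h]
  rfl

/-- The scalar part `pr₀ : C(V) → ⋀⁰ V = ℂ`, the degree zero component for the grading of
`⋀ V = C(V)`. -/
def pr0 (B : LinearMap.BilinForm ℂ V) (w : Cliff B) : ℂ :=
  ExteriorAlgebra.algebraMapInv (psi B w)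

/-- `pr₀ w`, as an element of `⋀⁰ V`, is the degree zero component of `w`. -/
theorem algebraMap_pr0 (B : LinearMap.BilinForm ℂ V) (w : Cliff B) :
    algebraMap ℂ (ExteriorAlgebra ℂ V) (pr0 B w) =
      GradedAlgebra.proj (fun i : ℕ => ⋀[ℂ]^i V) 0 (psi B w) := by
  unfold pr0
  generalize psi B w = u
  induction u using ExteriorAlgebra.induction with
  | algebraMap r =>
    rw [AlgHom.commutes, GradedAlgebra.proj_apply, DirectSum.decompose_of_mem_same]
    · rfl
    · exact SetLike.algebraMap_mem_graded _ r
  | ι x =>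
    rw [GradedAlgebra.proj_apply, DirectSum.decompose_of_mem_ne (i := 1) _ _ one_ne_zero]
    · simp [ExteriorAlgebra.algebraMapInv]
    · simp
  | mul a b ha hb =>
    have h := map_mul (GradedRing.projZeroRingHom (fun i : ℕ => ⋀[ℂ]^i V)) a b
    simp only [GradedRing.projZeroRingHom_apply, ← GradedAlgebra.proj_apply] at h
    rw [h, map_mul, map_mul, ha, hb]
  | add a b ha hb => rw [map_add, map_add, map_add, ha, hb]

theorem ι_injective (B : LinearMap.BilinForm ℂ V) :
    Function.Injective (CliffordAlgebra.ι (quad B)) := by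
  intro x y h
  have h2 := congrArg (psi B) h
  simp only [psi, equivExterior, changeFormEquiv_apply, changeForm_ι] at h2
  exact (ExteriorAlgebra.ι_inj ℂ x y).1 h2

/-- `Spin(V)`: all even `g ∈ C(V)` with `g α(g) = 1` and `g x α(g) ∈ V` for all `x ∈ V`. Here `α` is
the antiautomorphism of `C(V)` fixing `V` pointwise, and `V ⊆ C(V)` through `ι`. -/
def spin (B : LinearMap.BilinForm ℂ V) : Set (Cliff B) :=
  {g | g ∈ CliffordAlgebra.even (quad B) ∧ g * reverse g = 1 ∧
    ∀ x : V, g * CliffordAlgebra.ι (quad B) x * reverse g ∈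
      LinearMap.range (CliffordAlgebra.ι (quad B))}

/-- `Spin(V)` contains `-g` with `g`. -/
instance (B : LinearMap.BilinForm ℂ V) : Neg (spin B) where
  neg g := ⟨-(g : Cliff B), neg_mem g.2.1, by simpa using g.2.2.1, fun x => by
    simpa using g.2.2.2 x⟩

theorem coe_neg (B : LinearMap.BilinForm ℂ V) (g : spin B) :
    ((-g : spin B) : Cliff B) = -(g : Cliff B) := rfl

/-- The linear map `T(g) : V → V`, `T(g) x = g x α(g)`, for `g ∈ Spin(V)`. -/
def T (B : LinearMap.BilinForm ℂ V) (g : spin B) : V →ₗ[ℂ] V :=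
  (LinearEquiv.ofInjective (CliffordAlgebra.ι (quad B)) (ι_injective B)).symm.toLinearMap ∘ₗ
    LinearMap.codRestrict (LinearMap.range (CliffordAlgebra.ι (quad B)))
      (LinearMap.mulRight ℂ (reverse (g : Cliff B)) ∘ₗ LinearMap.mulLeft ℂ (g : Cliff B) ∘ₗ
        CliffordAlgebra.ι (quad B))
      (fun x => g.2.2.2 x)

theorem ι_T (B : LinearMap.BilinForm ℂ V) (g : spin B) (x : V) :
    CliffordAlgebra.ι (quad B) (T B g x) =
      (g : Cliff B) * CliffordAlgebra.ι (quad B) x * reverse (g : Cliff B) := by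
  have h := congrArg Subtype.val
    ((LinearEquiv.ofInjective (CliffordAlgebra.ι (quad B)) (ι_injective B)).apply_symm_apply
      ⟨_, g.2.2.2 x⟩)
  exact h

end Spinor

end

/-! Compute the trace of `u ↦ g u α(g)` on `C(V)` in two ways. Since `α(g) = g⁻¹`, this map is the
algebra automorphism induced by the isometry `T(g)`. The identification `psi` turns it into `⋀T(g)`,
whose trace is `det(1 + T(g))` (`trace_map`, `psi_map`). On the other hand, the trace of `u ↦ a u b`
is a trace functional in `a` and in `b`, and on even elements such functionals are multiples of
`pr0` (`trace_functional_apply_of_even`). Hence the trace is `2^n pr0(g) pr0(α(g)) = 2^n pr0(g)^2`,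
which is `det_one_add_T`.

For the fibre of `T`: if `T(h) = T(g)`, then `k = α(g) h` is even and commutes with `V`. The
commutator with `x` is contraction by `2(x, ·)`, so by nondegeneracy all contractions kill `k`. Then
`k` is a scalar, and `k α(k) = 1` gives `k = ±1`. -/

namespace Matrix

/-- The determinant of `1 + M` is the sum of all principal minors of `M`. -/
theorem det_one_add_eq_sum_minors {R I : Type*} [CommRing R] [Fintype I] [DecidableEq I]
    (M : Matrix I I R) :
    (1 + M).det =
      ∑ s : Finset I, (M.submatrix (Subtype.val : s → I) (Subtype.val : s → I)).det := by
  rw [add_comm]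
  refine ((detRowAlternating (R := R) (n := I)).map_add_univ M.row (1 : Matrix I I R).row).trans ?_
  exact Finset.sum_congr rfl fun s _ => det_piecewise_one_eq_submatrix_det M s

end Matrix

/-! ### Exterior algebra: trace of an induced map, and the Euler operator. -/

namespace ExteriorAlgebra

open Module Set exteriorPower

variable {R M I : Type*} [CommRing R] [AddCommGroup M] [Module R M]

theorem basis_repr_coe [LinearOrder I] (b : Basis I R M) {n : ℕ} (x : ⋀[R]^n M) (s : powersetCard I n) :
    b.ExteriorAlgebra.repr (x : ExteriorAlgebra R M) (s : Finset I) =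
      (b.exteriorPower n).repr x s := by
  have h : (b.ExteriorAlgebra.coord (s : Finset I)) ∘ₗ (⋀[R]^n M).subtype =
      (b.exteriorPower n).coord s := by
    refine (b.exteriorPower n).ext fun t => ?_
    rw [LinearMap.comp_apply, Submodule.subtype_apply, ← basis_eq_coe_basis, Basis.coord_apply,
      Basis.coord_apply, Basis.repr_self, Basis.repr_self]
    simp [Finsupp.single_apply, Subtype.ext_iff]
  exact LinearMap.congr_fun h x

/-- In the basis of wedges indexed by finite sets `s`, the diagonal entry of `⋀f` at `s` is the
principal minor of `f` on `s`. -/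
theorem trace_map [LinearOrder I] [Fintype I] (b : Basis I R M) (f : M →ₗ[R] M) :
    LinearMap.trace R (ExteriorAlgebra R M) (ExteriorAlgebra.map f).toLinearMap =
      LinearMap.det (1 + f) := by
  rw [LinearMap.trace_eq_matrix_trace R b.ExteriorAlgebra, ← LinearMap.det_toMatrix b, map_add,
    LinearMap.toMatrix_one, Matrix.det_one_add_eq_sum_minors, Matrix.trace]
  refine Finset.sum_congr rfl fun s _ => ?_
  set t : powersetCard I s.card := powersetCard.ofCard rfl with ht
  have h1 : ExteriorAlgebra.map f (b.ExteriorAlgebra s) =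
      ((exteriorPower.ιMulti R s.card (f ∘ b ∘ powersetCard.ofFinEmbEquiv.symm t) :
        ⋀[R]^s.card M) : ExteriorAlgebra R M) := by
    rw [basis_apply_ofCard b (rfl : s.card = s.card), ExteriorAlgebra.ιMulti_family,
      ExteriorAlgebra.map_apply_ιMulti]
    rfl
  rw [Matrix.diag_apply, LinearMap.toMatrix_apply, AlgHom.toLinearMap_apply, h1]
  refine (basis_repr_coe b _ t).trans ?_
  rw [exteriorPower.basis_repr_apply, ιMultiDual_apply_ιMulti, ← Matrix.det_transpose]
  let e : Fin s.card ≃ s := (s.orderIsoOfFin rfl).toEquiv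
  rw [← Matrix.det_submatrix_equiv_self e]
  congr 1
  ext i j
  simp [LinearMap.toMatrix_apply, e, ht]
  rfl

instance finite_of_finite [Nontrivial R] [Module.Free R M] [Module.Finite R M] :
    Module.Finite R (ExteriorAlgebra R M) := by
  let b := Module.finBasis R M
  exact Module.Finite.of_basis b.ExteriorAlgebra

/-- The operator `∑ i, b i ∧ (b.coord i ⌋ ·)` multiplies elements of degree `m` by `m`. -/
theorem sum_ι_mul_contractLeft [Fintype I] (b : Basis I R M) (m : ℕ) (u : ExteriorAlgebra R M)
    (hu : u ∈ ⋀[R]^m M) :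
    ∑ i, ι R (b i) * contractLeft (Q := (0 : QuadraticForm R M)) (b.coord i) u = m • u := by
  induction m generalizing u with
  | zero =>
    obtain ⟨r, rfl⟩ := Submodule.mem_one.1 hu
    simp [contractLeft_algebraMap (Q := (0 : QuadraticForm R M))]
  | succ m ih =>
    have hu' : u ∈ LinearMap.range (ι R : M →ₗ[R] ExteriorAlgebra R M) *
      LinearMap.range (ι R : M →ₗ[R] ExteriorAlgebra R M) ^ m := by rwa [← pow_succ']
    induction hu' using Submodule.mul_induction_on' with
    | mem_mul_mem x hx w hw =>
      obtain ⟨x, rfl⟩ := hx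
      have key (i) : ι R (b i) * contractLeft (Q := (0 : QuadraticForm R M)) (b.coord i)
          (ι R x * w) = ι R (b.coord i x • b i) * w +
            ι R x * (ι R (b i) * contractLeft (Q := (0 : QuadraticForm R M)) (b.coord i) w) := by
        have := contractLeft_ι_mul (Q := (0 : QuadraticForm R M)) (d := b.coord i) x w
        rw [show ι R x * w = CliffordAlgebra.ι (0 : QuadraticForm R M) x * w from rfl, this]
        -- The minus sign of the contraction rule cancels against moving `b i` past `x`, so the
        -- operator acts as a derivation.
        have anti : ι R x * ι R (b i) = - (ι R (b i) * ι R x) :=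
          eq_neg_of_add_eq_zero_left (ι_add_mul_swap x (b i))
        rw [← mul_assoc, anti, mul_sub, map_smul, smul_mul_assoc, mul_smul_comm, neg_mul,
          sub_eq_add_neg, mul_assoc]
      rw [Finset.sum_congr rfl fun i _ => key i, Finset.sum_add_distrib, ← Finset.sum_mul,
        ← map_sum, ← Finset.mul_sum, ih w hw]
      have : ∑ i, b.coord i x • b i = x := b.sum_repr x
      rw [this, succ_nsmul', mul_smul_comm]
    | add x hx y hy ihx ihy =>
      have hx' : x ∈ ⋀[R]^(m+1) M := by rwa [exteriorPower, pow_succ']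
      have hy' : y ∈ ⋀[R]^(m+1) M := by rwa [exteriorPower, pow_succ']
      rw [smul_add, ← ihx hx', ← ihy hy', ← Finset.sum_add_distrib]
      simp only [map_add, mul_add]

/-- An element of the exterior algebra killed by all contractions is a scalar. -/
theorem proj_zero_eq_self_of_contractLeft_eq_zero {K : Type*} [Field K] [CharZero K] [Module K M]
    [FiniteDimensional K M]
    (u : ExteriorAlgebra K M)
    (hu : ∀ d : Module.Dual K M, contractLeft (Q := (0 : QuadraticForm K M)) d u = 0) :
    GradedAlgebra.proj (fun i : ℕ => ⋀[K]^i M) 0 u = u := by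
  classical
  let b := Module.finBasis K M
  have euler (w : ExteriorAlgebra K M) (m : ℕ) : GradedAlgebra.proj (fun i : ℕ => ⋀[K]^i M) m
      (∑ i, ι K (b i) * contractLeft (Q := (0 : QuadraticForm K M)) (b.coord i) w) =
      m • GradedAlgebra.proj (fun i : ℕ => ⋀[K]^i M) m w := by
    induction w using DirectSum.Decomposition.inductionOn (fun i : ℕ => ⋀[K]^i M) with
    | zero => simp
    | @homogeneous i w =>
      rw [sum_ι_mul_contractLeft b i _ w.2, map_nsmul]
      by_cases h : i = m
      · subst h; rfl
      · rw [GradedAlgebra.proj_apply,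
          DirectSum.decompose_of_mem_ne (fun i : ℕ => ⋀[K]^i M) w.2 h, smul_zero, smul_zero]
    | add x y hx hy =>
      rw [map_add, smul_add, ← hx, ← hy, ← map_add, ← Finset.sum_add_distrib]
      simp only [map_add, mul_add]
  have hz (m : ℕ) (hm : m ≠ 0) : GradedAlgebra.proj (fun i : ℕ => ⋀[K]^i M) m u = 0 := by
    have := euler u m
    simp only [hu, mul_zero, Finset.sum_const_zero, map_zero] at this
    rw [← Nat.cast_smul_eq_nsmul K] at this
    exact (smul_eq_zero.1 this.symm).resolve_left (by exact_mod_cast hm)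
  conv_rhs => rw [← DirectSum.sum_support_decompose (fun i : ℕ => ⋀[K]^i M) u]
  rw [Finset.sum_eq_single 0]
  · rfl
  · exact fun m _ hm => hz m hm
  · intro h
    rw [DFinsupp.notMem_support_iff.1 h]; rfl

end ExteriorAlgebra
noncomputable section

/-! ### Contractions on Clifford algebras. -/

namespace CliffordAlgebra

variable {R M N : Type*} [CommRing R] [AddCommGroup M] [Module R M] [AddCommGroup N] [Module R N]

theorem contractLeft_map {Q : QuadraticForm R M} {Q' : QuadraticForm R N} (f : Q →qᵢ Q')
    (d : Module.Dual R N) (u : CliffordAlgebra Q) :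
    contractLeft d (map f u) = map f (contractLeft (d ∘ₗ f.toLinearMap) u) := by
  induction u using CliffordAlgebra.left_induction with
  | algebraMap r => rw [AlgHom.commutes, contractLeft_algebraMap, contractLeft_algebraMap, map_zero]
  | add x y hx hy => simp only [map_add, hx, hy]
  | ι_mul x m hx =>
    rw [map_mul, map_apply_ι, contractLeft_ι_mul, contractLeft_ι_mul, hx, map_sub, map_mul,
      map_smul, map_apply_ι]
    rfl

/-- The twisted commutator with a vector is a contraction. -/
theorem ι_mul_sub_involute_mul_ι (Q : QuadraticForm R M) (x : M) (w : CliffordAlgebra Q) :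
    ι Q x * w - involute w * ι Q x = contractLeft (QuadraticMap.polarBilin Q x) w := by
  induction w using CliffordAlgebra.left_induction with
  | algebraMap r =>
    rw [AlgHom.commutes, contractLeft_algebraMap, Algebra.commutes, sub_self]
  | add a b ha hb => rw [map_add, map_add, ← ha, ← hb, mul_add, add_mul]; abel
  | ι_mul w m hw =>
    rw [contractLeft_ι_mul, ← hw, map_mul, involute_ι, Algebra.smul_def,
      QuadraticMap.polarBilin_apply_apply, ← ι_mul_ι_add_swap]
    noncomm_ring

/-- Contraction lowers the filtration degree by one. -/
theorem contractLeft_mem_pow {Q : QuadraticForm R M} (d : Module.Dual R M) (k : ℕ)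
    (w : CliffordAlgebra Q) (hw : w ∈ LinearMap.range (ι Q) ^ (k + 1)) :
    contractLeft d w ∈ LinearMap.range (ι Q) ^ k := by
  induction k generalizing w with
  | zero =>
    rw [zero_add, pow_one] at hw
    obtain ⟨x, rfl⟩ := hw
    rw [contractLeft_ι, pow_zero]
    exact Submodule.algebraMap_mem _
  | succ k ih =>
    rw [pow_succ'] at hw
    induction hw using Submodule.mul_induction_on' with
    | mem_mul_mem x hx u hu =>
      obtain ⟨x, rfl⟩ := hx
      rw [contractLeft_ι_mul]
      refine sub_mem (Submodule.smul_mem _ _ hu) ?_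
      rw [pow_succ']
      exact Submodule.mul_mem_mul ⟨x, rfl⟩ (ih u hu)
    | add x _ y _ hx hy => rw [map_add]; exact add_mem hx hy

/-- A linear form on the even part is determined by its value at `1` and by a recursion along
contractions. -/
theorem eq_zero_of_even {P : Type*} [AddCommGroup P] [Module R P] {Q : QuadraticForm R M}
    (D : M → Module.Dual R M) (χ : CliffordAlgebra Q →ₗ[R] P) (h1 : χ 1 = 0)
    (h : ∀ (x : M) (w : CliffordAlgebra Q), w ∈ evenOdd Q 1 →
      χ (ι Q x * w) = χ (contractLeft (D x) w))
    (a : CliffordAlgebra Q) (ha : a ∈ evenOdd Q 0) : χ a = 0 := by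
  -- Products of `2k + 2` vectors reduce to products of `2k`: split off one vector, then contract
  -- the remaining `2k + 1`.
  have key (k : ℕ) : ∀ a ∈ LinearMap.range (ι Q) ^ (2 * k), χ a = 0 := by
    induction k with
    | zero =>
      intro a ha
      obtain ⟨r, rfl⟩ := Submodule.mem_one.1 ha
      rw [Algebra.algebraMap_eq_smul_one, map_smul, h1, smul_zero]
    | succ k ih =>
      intro a ha
      rw [show 2 * (k + 1) = 2 * k + 1 + 1 by ring, pow_succ'] at ha
      induction ha using Submodule.mul_induction_on' with
      | mem_mul_mem x hx u hu =>
        obtain ⟨x, rfl⟩ := hx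
        rw [h x u, ih _ (contractLeft_mem_pow _ _ _ hu)]
        refine Submodule.mem_iSup_of_mem ⟨2 * k + 1, ?_⟩ hu
        push_cast
        rw [show (2 : ZMod 2) = 0 from rfl, zero_mul, zero_add]
      | add x _ y _ hx hy => rw [map_add, hx, hy, add_zero]
  refine Submodule.iSup_induction _ (motive := fun a => χ a = 0) ha ?_ (map_zero χ) ?_
  · rintro ⟨m, hm⟩ a ha
    obtain ⟨k, rfl⟩ := (ZMod.natCast_eq_zero_iff m 2).1 hm
    exact key k a ha
  · intro x y hx hy
    rw [map_add, hx, hy, add_zero]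

end CliffordAlgebra

/-! ### Trace functionals and the scalar part. -/

namespace Spinor

variable {V : Type*} [AddCommGroup V] [Module ℂ V]

/-- The scalar part as a linear form. -/
def pr0Linear (B : LinearMap.BilinForm ℂ V) : Cliff B →ₗ[ℂ] ℂ :=
  ExteriorAlgebra.algebraMapInv.toLinearMap ∘ₗ (psi B).toLinearMap

theorem pr0Linear_apply (B : LinearMap.BilinForm ℂ V) (w : Cliff B) :
    pr0Linear B w = pr0 B w := rfl

theorem pr0_one (B : LinearMap.BilinForm ℂ V) : pr0 B 1 = 1 := by
  rw [pr0, psi_one, map_one]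

theorem pr0_neg (B : LinearMap.BilinForm ℂ V) (w : Cliff B) : pr0 B (-w) = -pr0 B w :=
  map_neg (pr0Linear B) w

theorem psi_contractLeft (B : LinearMap.BilinForm ℂ V) (d : Module.Dual ℂ V) (u : Cliff B) :
    psi B (contractLeft d u) = contractLeft (Q := (0 : QuadraticForm ℂ V)) d (psi B u) :=
  changeForm_contractLeft changeForm.associated_neg_proof d u

theorem pr0_ι_mul (B : LinearMap.BilinForm ℂ V) (hB : B.IsSymm) (x : V) (w : Cliff B) :
    pr0 B (ι (quad B) x * w) = pr0 B (contractLeft (B x) w) := by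
  rw [pr0, psi_ι_mul B hB, map_add, map_mul, pr0, psi_contractLeft]
  simp [ExteriorAlgebra.algebraMapInv]

theorem polarBilin_quad (B : LinearMap.BilinForm ℂ V) (hB : B.IsSymm) (x : V) :
    QuadraticMap.polarBilin (quad B) x = (2 : ℂ) • B x := by
  ext y
  have := hB.eq x y
  simp [QuadraticMap.polar, ← this]
  ring

theorem ι_mul_add_mul_ι_of_odd (B : LinearMap.BilinForm ℂ V) (hB : B.IsSymm) (x : V) (w : Cliff B)
    (hw : w ∈ evenOdd (quad B) 1) :
    ι (quad B) x * w + w * ι (quad B) x = (2 : ℂ) • contractLeft (B x) w := by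
  have := ι_mul_sub_involute_mul_ι (quad B) x w
  rwa [involute_eq_of_mem_odd hw, neg_mul, sub_neg_eq_add, polarBilin_quad B hB, map_smul] at this

theorem ι_mul_sub_mul_ι_of_even (B : LinearMap.BilinForm ℂ V) (hB : B.IsSymm) (x : V)
    (w : Cliff B) (hw : w ∈ evenOdd (quad B) 0) :
    ι (quad B) x * w - w * ι (quad B) x = (2 : ℂ) • contractLeft (B x) w := by
  have := ι_mul_sub_involute_mul_ι (quad B) x w
  rwa [involute_eq_of_mem_even hw, polarBilin_quad B hB, map_smul] at this

/-- On even elements every trace functional is a multiple of the scalar part. -/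
theorem trace_functional_apply_of_even (B : LinearMap.BilinForm ℂ V) (hB : B.IsSymm)
    (φ : Cliff B →ₗ[ℂ] ℂ) (hφ : ∀ a b, φ (a * b) = φ (b * a)) (a : Cliff B)
    (ha : a ∈ evenOdd (quad B) 0) : φ a = pr0 B a * φ 1 := by
  have h := eq_zero_of_even (fun x => B x) (φ - φ 1 • pr0Linear B)
    (by simp [pr0Linear_apply, pr0_one]) (fun x w hw => ?_) a ha
  · rw [LinearMap.sub_apply, sub_eq_zero] at h
    rw [h, LinearMap.smul_apply, smul_eq_mul, mul_comm, pr0Linear_apply]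
  -- Apply `φ` to `xw + wx = 2 ι(x)w`. Both terms on the left have the same value, so `φ` satisfies
  -- the recursion of `pr0`.
  · have h2 := congrArg φ (ι_mul_add_mul_ι_of_odd B hB x w hw)
    rw [map_add, hφ w, ← two_mul, map_smul, smul_eq_mul] at h2
    have h3 := mul_left_cancel₀ (two_ne_zero' ℂ) h2
    simp only [LinearMap.sub_apply, LinearMap.smul_apply, pr0Linear_apply, h3, pr0_ι_mul B hB]

instance (B : LinearMap.BilinForm ℂ V) [FiniteDimensional ℂ V] :
    FiniteDimensional ℂ (Cliff B) :=
  Module.Finite.equiv (psi B).symm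

/-- The trace of `u ↦ a u b` on `C(V)`, as a bilinear function of `a` and `b`. -/
def trMul (B : LinearMap.BilinForm ℂ V) : Cliff B →ₗ[ℂ] Cliff B →ₗ[ℂ] ℂ :=
  LinearMap.compr₂ ((LinearMap.mul ℂ (Module.End ℂ (Cliff B))).compl₁₂
    (LinearMap.mul ℂ (Cliff B)) (LinearMap.mul ℂ (Cliff B)).flip)
    (LinearMap.trace ℂ (Cliff B))

theorem trMul_apply (B : LinearMap.BilinForm ℂ V) (a b : Cliff B) :
    trMul B a b = LinearMap.trace ℂ (Cliff B) (LinearMap.mulLeft ℂ a * LinearMap.mulRight ℂ b) :=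
  rfl

theorem trMul_mul_left (B : LinearMap.BilinForm ℂ V) (a a' b : Cliff B) :
    trMul B (a * a') b = trMul B (a' * a) b := by
  rw [trMul_apply, trMul_apply, LinearMap.mulLeft_mul, LinearMap.mulLeft_mul]
  change LinearMap.trace ℂ _ (LinearMap.mulLeft ℂ a * LinearMap.mulLeft ℂ a' *
    LinearMap.mulRight ℂ b) = LinearMap.trace ℂ _ (LinearMap.mulLeft ℂ a' *
    LinearMap.mulLeft ℂ a * LinearMap.mulRight ℂ b)
  rw [mul_assoc, LinearMap.trace_mul_comm, mul_assoc, mul_assoc]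
  congr 2
  exact (LinearMap.commute_mulLeft_right a b).symm.eq

theorem trMul_mul_right (B : LinearMap.BilinForm ℂ V) (a b b' : Cliff B) :
    trMul B a (b * b') = trMul B a (b' * b) := by
  rw [trMul_apply, trMul_apply, LinearMap.mulRight_mul, LinearMap.mulRight_mul]
  change LinearMap.trace ℂ _ (LinearMap.mulLeft ℂ a * (LinearMap.mulRight ℂ b' *
    LinearMap.mulRight ℂ b)) = LinearMap.trace ℂ _ (LinearMap.mulLeft ℂ a *
    (LinearMap.mulRight ℂ b * LinearMap.mulRight ℂ b'))
  rw [← mul_assoc, LinearMap.trace_mul_comm, ← mul_assoc, ← mul_assoc]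
  congr 2
  exact (LinearMap.commute_mulLeft_right a b).symm.eq

theorem trMul_eq (B : LinearMap.BilinForm ℂ V) (hB : B.IsSymm) (a b : Cliff B)
    (ha : a ∈ evenOdd (quad B) 0) (hb : b ∈ evenOdd (quad B) 0) :
    trMul B a b = pr0 B a * pr0 B b * trMul B 1 1 := by
  have h1 := trace_functional_apply_of_even B hB ((trMul B).flip b)
    (fun x y => trMul_mul_left B x y b) a ha
  have h2 := trace_functional_apply_of_even B hB (trMul B 1)
    (fun x y => trMul_mul_right B 1 x y) b hb
  rw [LinearMap.flip_apply, LinearMap.flip_apply] at h1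
  rw [h1, h2, mul_assoc]

theorem trMul_one_one (B : LinearMap.BilinForm ℂ V) [FiniteDimensional ℂ V] :
    trMul B 1 1 = 2 ^ Module.finrank ℂ V := by
  have h := ExteriorAlgebra.trace_map (Module.finBasis ℂ V) (LinearMap.id : V →ₗ[ℂ] V)
  have hid : (ExteriorAlgebra.map (LinearMap.id : V →ₗ[ℂ] V)).toLinearMap = 1 := by
    rw [ExteriorAlgebra.map_id]; rfl
  have h2 : (1 + LinearMap.id : V →ₗ[ℂ] V) = (2 : ℂ) • LinearMap.id := by
    rw [two_smul]; rfl
  rw [hid, h2, LinearMap.det_smul, LinearMap.det_id, mul_one] at h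
  rw [← h, trMul_apply, LinearMap.mulLeft_one, LinearMap.mulRight_one,
    ← LinearMap.trace_conj' _ (psi B)]
  congr 1
  ext
  simp

/-- Conjugation by `α` turns left multiplication by `α(a)` into right multiplication by `a`, so the
two traces agree; each is `2^n` times a scalar part. -/
theorem pr0_reverse (B : LinearMap.BilinForm ℂ V) [FiniteDimensional ℂ V] (hB : B.IsSymm)
    (a : Cliff B) (ha : a ∈ evenOdd (quad B) 0) : pr0 B (reverse a) = pr0 B a := by
  have one : (1 : Cliff B) ∈ evenOdd (quad B) 0 := SetLike.GradedOne.one_mem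
  have h1 := trMul_eq B hB (reverse a) 1 ((reverse_mem_evenOdd_iff _).2 ha) one
  have h2 := trMul_eq B hB 1 a one ha
  have h3 : trMul B (reverse a) 1 = trMul B 1 a := by
    rw [trMul_apply, trMul_apply, ← LinearMap.trace_conj' _ reverseEquiv]
    congr 1
    refine LinearMap.ext fun w => ?_
    obtain ⟨u, rfl⟩ := (reverseEquiv (Q := quad B)).surjective w
    rw [LinearEquiv.conj_apply_apply, LinearEquiv.symm_apply_apply]
    change reverse (reverse a * (u * 1)) = 1 * (reverse u * a)
    rw [reverse.map_mul, reverse_reverse, mul_one, one_mul]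
  rw [pr0_one, mul_one] at h1
  rw [pr0_one, one_mul] at h2
  refine mul_right_cancel₀ ?_ (h1.symm.trans (h3.trans h2))
  rw [trMul_one_one]
  exact pow_ne_zero _ two_ne_zero

/-! ### The action of `Spin(V)` and the fibres of `T`. -/

variable {B : LinearMap.BilinForm ℂ V}

theorem reverse_mul_self [FiniteDimensional ℂ V] (g : spin B) :
    reverse (g : Cliff B) * g = 1 := by
  -- In finite dimension a one-sided inverse of an operator is two-sided.
  have h : LinearMap.mulLeft ℂ (g : Cliff B) * LinearMap.mulLeft ℂ (reverse (g : Cliff B)) = 1 := by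
    ext u
    change (g : Cliff B) * (reverse (g : Cliff B) * u) = u
    rw [← mul_assoc, g.2.2.1, one_mul]
  simpa using LinearMap.congr_fun (_root_.mul_eq_one_comm.1 h) 1

theorem coe_mem_evenOdd (g : spin B) : (g : Cliff B) ∈ evenOdd (quad B) 0 := by
  rw [← even_toSubmodule]; exact g.2.1

/-- `T(g)` preserves the quadratic form. -/
def isometryT [FiniteDimensional ℂ V] (g : spin B) : quad B →qᵢ quad B where
  toLinearMap := T B g
  map_app' x := by
    apply (algebraMap ℂ (Cliff B)).injective
    change algebraMap ℂ (Cliff B) (quad B (T B g x)) = _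
    rw [← ι_sq_scalar, ι_T]
    have : ∀ a b y : Cliff B, b * a = 1 → a * y * b * (a * y * b) = a * (y * y) * b := by
      intro a b y h
      calc a * y * b * (a * y * b) = a * y * (b * a) * y * b := by noncomm_ring
        _ = _ := by rw [h]; noncomm_ring
    rw [this _ _ _ (reverse_mul_self g), ι_sq_scalar, ← Algebra.commutes, mul_assoc, g.2.2.1,
      mul_one]

theorem map_isometryT [FiniteDimensional ℂ V] (g : spin B) (u : Cliff B) :
    CliffordAlgebra.map (isometryT g) u = g * u * reverse (g : Cliff B) := by
  induction u using CliffordAlgebra.left_induction with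
  | algebraMap r => rw [AlgHom.commutes, ← Algebra.commutes, mul_assoc, g.2.2.1, mul_one]
  | add x y hx hy => rw [map_add, hx, hy, mul_add, add_mul]
  | ι_mul x m hx =>
    rw [map_mul, hx, map_apply_ι]
    change ι (quad B) (T B g m) * _ = _
    rw [ι_T]
    calc _ = g * ι (quad B) m * (reverse (g : Cliff B) * g) * x * reverse (g : Cliff B) := by
          noncomm_ring
      _ = _ := by rw [reverse_mul_self]; noncomm_ring

/-- An isometry `f` carries the linear form `(x, ·)` to `(f x, ·)`, so `⋀f` respects both the wedge
and the contraction that make up `γ(x)`. -/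
theorem psi_map (hB : B.IsSymm) (f : quad B →qᵢ quad B) (u : Cliff B) :
    psi B (CliffordAlgebra.map f u) = ExteriorAlgebra.map f.toLinearMap (psi B u) := by
  induction u using CliffordAlgebra.left_induction with
  | algebraMap r =>
    rw [AlgHom.commutes, Algebra.algebraMap_eq_smul_one, map_smul, map_smul, psi_one, map_one]
  | add x y hx hy => simp only [map_add, hx, hy]
  | ι_mul u m hu =>
    have hf : B (f m) ∘ₗ f.toLinearMap = B m := by
      have h (x y : V) : QuadraticMap.polar (quad B) x y = 2 * B x y :=
        LinearMap.congr_fun (polarBilin_quad B hB x) y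
      ext y
      have h2 : QuadraticMap.polar (quad B) (f m) (f y) = QuadraticMap.polar (quad B) m y := by
        simp only [QuadraticMap.polar, ← map_add, f.map_app]
      rw [h, h] at h2
      exact mul_left_cancel₀ two_ne_zero h2
    have hc := contractLeft_map (Q := (0 : QuadraticForm ℂ V)) (Q' := (0 : QuadraticForm ℂ V))
      ⟨f.toLinearMap, fun _ => rfl⟩ (B (f m)) (psi B u)
    rw [map_mul, map_apply_ι, psi_ι_mul B hB, psi_ι_mul B hB, hu, map_add, map_mul,
      ExteriorAlgebra.map_apply_ι]
    congr 1
    refine hc.trans ?_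
    change ExteriorAlgebra.map f.toLinearMap (contractLeft (B (f m) ∘ₗ f.toLinearMap) _) = _
    rw [hf]

theorem det_one_add_T [FiniteDimensional ℂ V] (hB : B.IsSymm) (g : spin B) :
    LinearMap.det (1 + T B g) = 2 ^ Module.finrank ℂ V * pr0 B g ^ 2 := by
  have h := trMul_eq B hB g (reverse (g : Cliff B)) (coe_mem_evenOdd g)
    ((reverse_mem_evenOdd_iff _).2 (coe_mem_evenOdd g))
  rw [pr0_reverse B hB _ (coe_mem_evenOdd g), trMul_one_one] at h
  rw [← ExteriorAlgebra.trace_map (Module.finBasis ℂ V), mul_comm, sq, ← h, trMul_apply,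
    ← LinearMap.trace_conj' _ (psi B)]
  congr 1
  refine LinearMap.ext fun w => ?_
  obtain ⟨u, rfl⟩ := (psi B).surjective w
  rw [LinearEquiv.conj_apply_apply, LinearEquiv.symm_apply_apply]
  refine (psi_map hB (isometryT g) u).symm.trans ?_
  rw [map_isometryT, mul_assoc]
  rfl

/-- An even element commuting with all vectors is a scalar. -/
theorem eq_algebraMap_pr0_of_commute [FiniteDimensional ℂ V] (hB : B.IsSymm)
    (hnd : B.Nondegenerate) (k : Cliff B) (hk : k ∈ evenOdd (quad B) 0)
    (hc : ∀ x, ι (quad B) x * k = k * ι (quad B) x) : k = algebraMap ℂ _ (pr0 B k) := by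
  have h0 (d : Module.Dual ℂ V) : contractLeft (Q := quad B) d k = 0 := by
    obtain ⟨x, rfl⟩ : ∃ x, B x = d := (B.toDual hnd).surjective d
    have := ι_mul_sub_mul_ι_of_even B hB x k hk
    rw [hc, sub_self] at this
    exact (smul_eq_zero.1 this.symm).resolve_left two_ne_zero
  have h1 := ExteriorAlgebra.proj_zero_eq_self_of_contractLeft_eq_zero (psi B k) fun d => by
    rw [← psi_contractLeft, h0, map_zero]
  rw [← algebraMap_pr0] at h1
  apply (psi B).injective
  rw [← h1, Algebra.algebraMap_eq_smul_one, Algebra.algebraMap_eq_smul_one, map_smul, psi_one]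

theorem T_neg (g : spin B) : T B (-g) = T B g := by
  ext x
  apply ι_injective B
  rw [ι_T, ι_T, coe_neg, map_neg, neg_mul, neg_mul_neg]

theorem T_eq_T_iff [FiniteDimensional ℂ V] (hB : B.IsSymm) (hnd : B.Nondegenerate)
    (g h : spin B) : T B h = T B g ↔ h = g ∨ h = -g := by
  refine ⟨fun hT => ?_, ?_⟩
  · set k : Cliff B := reverse (g : Cliff B) * h with hk
    have hke : k ∈ evenOdd (quad B) 0 := by
      rw [← even_toSubmodule]
      refine (CliffordAlgebra.even (quad B)).mul_mem ?_ h.2.1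
      have := (reverse_mem_evenOdd_iff _).2 (coe_mem_evenOdd g)
      rwa [← even_toSubmodule] at this
    have hkc (x : V) : ι (quad B) x * k = k * ι (quad B) x := by
      have e : (h : Cliff B) * ι (quad B) x * reverse (h : Cliff B) =
          g * ι (quad B) x * reverse (g : Cliff B) := by
        rw [← ι_T, ← ι_T, hT]
      calc ι (quad B) x * k = (reverse (g : Cliff B) * g) * ι (quad B) x * k := by
            rw [reverse_mul_self, one_mul]
        _ = reverse (g : Cliff B) * (g * ι (quad B) x * reverse (g : Cliff B)) * h := by
            rw [hk]; noncomm_ring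
        _ = k * ι (quad B) x * (reverse (h : Cliff B) * h) := by
            rw [← e, hk]; noncomm_ring
        _ = _ := by rw [reverse_mul_self, mul_one]
    have hs := eq_algebraMap_pr0_of_commute hB hnd k hke hkc
    have hh : (h : Cliff B) = g * k := by rw [hk, ← mul_assoc, g.2.2.1, one_mul]
    have hkk : k * reverse k = 1 := by
      rw [hk, reverse.map_mul, reverse_reverse]
      calc _ = reverse (g : Cliff B) * (h * reverse (h : Cliff B)) * g := by noncomm_ring
        _ = 1 := by rw [h.2.2.1, mul_one, reverse_mul_self]
    have hsq : pr0 B k * pr0 B k = 1 := by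
      apply (algebraMap ℂ (Cliff B)).injective
      rw [map_mul, map_one]
      rw [hs, reverse.commutes] at hkk
      exact hkk
    rcases mul_self_eq_one_iff.1 hsq with h1 | h1
    · left
      apply Subtype.ext
      rw [hh, hs, h1, map_one, mul_one]
    · right
      apply Subtype.ext
      rw [hh, hs, h1, map_neg, map_one, mul_neg, mul_one, coe_neg]
  · rintro (rfl | rfl)
    · rfl
    · exact T_neg g

theorem ne_neg_self (g : spin B) : g ≠ -g := by
  intro h
  have h2 := congrArg Subtype.val h
  rw [coe_neg] at h2
  have h3 : (2 : ℂ) • (g : Cliff B) = 0 := by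
    rw [two_smul]; nth_rewrite 1 [h2]; exact neg_add_cancel _
  have h4 := (smul_eq_zero.1 h3).resolve_left two_ne_zero
  have h5 := g.2.2.1
  rw [h4, zero_mul] at h5
  exact zero_ne_one h5

theorem two_rpow_neg_half_sq (n : ℕ) :
    (2 : ℂ) ^ n * ((((2 : ℝ) ^ (-(n : ℝ) / 2) : ℝ) : ℂ)) ^ 2 = 1 := by
  have : (2 : ℝ) ^ n * ((2 : ℝ) ^ (-(n : ℝ) / 2)) ^ 2 = 1 := by
    rw [← Real.rpow_natCast, ← Real.rpow_natCast, ← Real.rpow_mul zero_le_two,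
      ← Real.rpow_add zero_lt_two]
    rw [show (n : ℝ) + -(n : ℝ) / 2 * (2 : ℕ) = 0 by push_cast; ring, Real.rpow_zero]
  exact_mod_cast this

end Spinor

end

theorem theorem7p10 {V : Type*} [AddCommGroup V] [Module ℂ V] [FiniteDimensional ℂ V]
    (B : LinearMap.BilinForm ℂ V) (hsymm : B.IsSymm) (hnondeg : B.Nondegenerate)
    (n : ℕ) (hn : Module.finrank ℂ V = n) (g : Spinor.spin B) :
    -- the scalar part vanishes off `Spin(V)*`
    (LinearMap.det (1 + Spinor.T B g) = 0 → Spinor.pr0 B g = 0) ∧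
    -- on `Spin(V)*` it is `2^(-n/2)` times one of the two square roots
    (LinearMap.det (1 + Spinor.T B g) ≠ 0 →
      ∃ s : ℂ, s ^ 2 = LinearMap.det (1 + Spinor.T B g) ∧
        Spinor.pr0 B g = (((2 : ℝ) ^ (-(n : ℝ) / 2) : ℝ) : ℂ) * s) ∧
    -- there are exactly two elements over `T(g)`, namely `g` and `-g`
    (g ≠ -g ∧ ∀ h : Spinor.spin B, Spinor.T B h = Spinor.T B g ↔ h = g ∨ h = -g) ∧
    -- on `Spin(V)*` each of the two square roots occurs for exactly one of these two elements
    (LinearMap.det (1 + Spinor.T B g) ≠ 0 →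
      ∀ s : ℂ, s ^ 2 = LinearMap.det (1 + Spinor.T B g) →
        ∃! h : Spinor.spin B, Spinor.T B h = Spinor.T B g ∧
          Spinor.pr0 B h = (((2 : ℝ) ^ (-(n : ℝ) / 2) : ℝ) : ℂ) * s) := by
  have hdet := Spinor.det_one_add_T hsymm g
  have hc := Spinor.two_rpow_neg_half_sq n
  rw [hn] at hdet
  set c : ℂ := (((2 : ℝ) ^ (-(n : ℝ) / 2) : ℝ) : ℂ)
  set p := Spinor.pr0 B g with hp
  -- From `2^n c² = 1` and `det(1 + T(g)) = 2^n p²`, the number `p / c` is a square root of the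
  -- determinant; it is the witness below.
  have hc0 : c ≠ 0 := by rintro h; rw [h] at hc; simp at hc
  refine ⟨fun h => ?_, fun _ => ⟨p / c, ?_, ?_⟩, ⟨Spinor.ne_neg_self g,
    fun h => Spinor.T_eq_T_iff hsymm hnondeg g h⟩, fun h0 s hs => ?_⟩
  · rw [hdet] at h
    simpa using h
  · rw [hdet, div_pow, div_eq_iff (pow_ne_zero 2 hc0)]
    linear_combination (-p ^ 2) * hc
  · field_simp
  · have hp0 : p ≠ 0 := by rintro h; rw [hdet, h] at h0; simp at h0
    have hsq : p ^ 2 = (c * s) ^ 2 := by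
      rw [mul_pow, hs, hdet]
      linear_combination (-p ^ 2) * hc
    -- Since `p ≠ 0`, the scalar part separates `g` from `-g`, which gives uniqueness.
    have hne : p ≠ -p := fun h => hp0 (self_eq_neg.1 h)
    have hneg : Spinor.pr0 B (-g : Spinor.spin B) = -p := by
      rw [Spinor.coe_neg, Spinor.pr0_neg]
    rcases sq_eq_sq_iff_eq_or_eq_neg.1 hsq with h | h
    · refine ⟨g, ⟨rfl, h⟩, fun k hk => ?_⟩
      rcases (Spinor.T_eq_T_iff hsymm hnondeg g k).1 hk.1 with rfl | rfl
      · rfl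
      · exact absurd (h.trans (hk.2.symm.trans hneg)) hne
    · have h' : -p = c * s := by rw [h, neg_neg]
      refine ⟨-g, ⟨Spinor.T_neg g, hneg.trans h'⟩, fun k hk => ?_⟩
      rcases (Spinor.T_eq_T_iff hsymm hnondeg g k).1 hk.1 with rfl | rfl
      · exact absurd (hk.2.trans h'.symm) hne
      · rfl
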